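/- Let $q:\mathbb R\to\mathbb R$ be an even function in $L^1_{loc}(\mathbb R)$ such that $\tau_q(y)=-y''-qy$ is in the limit circle case at $+\infty$ and at $-\infty$, that is, for every $\lambda\in\mathbb C$ all solutions of $\tau_q(y)-\lambda y=0$ are square integrable near $+\infty$ and near $-\infty$. Let $\mathcal D_{\max}=\{y\in L^2(\mathbb R): y,y'\in AC_{loc}(\mathbb R),\ \tau_q(y)\in L^2(\mathbb R)\}$ and let $A_{\max}y=\tau_q(y)$ for $y\in\mathcal D_{\max}$ be the maximal operator in $L^2(\mathbb R)$. Write $[f,g]_x=\overline{f(x)}g'(x)-\overline{f'(x)}g(x)$ and $[f,g]_{\pm\infty}=\lim_{x\to\pm\infty}[f,g]_x$. Let $w_1,w_2$ be real valued solutions of $\tau_q(y)=0$ with $w_1$ odd, $w_2$ even and $[w_1,w_2]_{-\infty}=[w_1,w_2]_{\infty}=1$, and for $f\in\mathcal D_{\max}$ put $\alpha_j(f)=[w_j,f]_{-\infty}$, $\beta_j(f)=[w_j,f]_{\infty}$, $j=1,2$. Below, $\widetilde A$ is always the restriction of $A_{\max}$ to the $f\in\mathcal D_{\max}$ that satisfy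 the stated boundary conditions. (1) (Separated boundary conditions.) Let $\widetilde A$ be given by $$\alpha_1(f)\,\xi\cos\alpha-\alpha_2(f)\sin\alpha=0,\qquad \beta_1(f)\,\eta\cos\beta-\beta_2(f)\sin\beta=0,$$ where $\xi,\eta\in\mathbb C$, $|\xi|=|\eta|=1$ and $\alpha,\beta\in[0,2\pi)$. Then $\widetilde A=\widetilde A^*$ if and only if ($\xi=\pm1$ or $\sin\alpha\cos\alpha=0$) and ($\eta=\pm1$ or $\sin\beta\cos\beta=0$). In particular, call $(\xi,\alpha)$ normalized if $\xi\neq-1$, and $\xi=1$ in case $\sin\alpha\cos\alpha=0$. If $(\xi,\alpha)$ and $(\eta,\beta)$ are normalized, then $\widetilde A=\widetilde A^*$ if and only if $\xi=\eta=1$. Moreover, every extension given by separated boundary conditions $a\,\alpha_1(f)+b\,\alpha_2(f)=0$, $c\,\beta_1(f)+d\,\beta_2(f)=0$ with $a,b,c,d\in\mathbb C$, $(a,b)\ne(0,0)$, $(c,d)\neq(0,0)$ is equal to the one given by such $\xi,\eta,\alpha,\beta$ with $(\xi,\alpha)$ and $(\eta,\beta)$ normalized. (2) (Mixed boundary conditions.)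 Let $a,b,c,d\in\mathbb C$, let $\widetilde A$ be given by $$\begin{pmatrix}\alpha_1(f)\\ \alpha_2(f)\end{pmatrix}=\begin{bmatrix}a&b\\c&d\end{bmatrix}\begin{pmatrix}\beta_1(f)\\ \beta_2(f)\end{pmatrix}\qquad\text{or by}\qquad \begin{pmatrix}\beta_1(f)\\ \beta_2(f)\end{pmatrix}=\begin{bmatrix}a&b\\c&d\end{bmatrix}\begin{pmatrix}\alpha_1(f)\\ \alpha_2(f)\end{pmatrix},$$ and set $\Delta=ad-bc$. In either case $\widetilde A=\widetilde A^*$ if and only if for some $\varphi\in\mathbb R$ we have $\Delta=e^{2i\varphi}$ and $e^{-i\varphi}a,\ e^{-i\varphi}b,\ e^{-i\varphi}c,\ e^{-i\varphi}d\in\mathbb R$. -/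

import Mathlib

open MeasureTheory Filter Topology

noncomputable section

namespace SturmLiouville

/-- The Hilbert space `L²(ℝ)` of (classes of) complex valued functions. -/
abbrev L2 : Type := Lp ℂ 2 (volume : Measure ℝ)

/-- `AC_loc(ℝ)`: absolutely continuous on all compact intervals. -/
def LocAC (y : ℝ → ℂ) : Prop :=
  ∀ a b : ℝ, AbsolutelyContinuousOnInterval y a b

/-- `y, y' ∈ AC_loc(ℝ)`.  As `y'` is then continuous and `y` is an integral of `y'`, this means
that `y` is differentiable everywhere with `y' ∈ AC_loc(ℝ)`; conversely such a `y` is continuously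
differentiable, hence itself in `AC_loc(ℝ)`, see `Regular.locAC`. -/
structure Regular (y : ℝ → ℂ) : Prop where
  differentiable : Differentiable ℝ y
  locAC_deriv : LocAC (deriv y)

/-- The differential expression `τ_q(y) = -y'' - q y` (defined almost everywhere). -/
def tau (q : ℝ → ℝ) (y : ℝ → ℂ) : ℝ → ℂ :=
  fun x => -deriv (deriv y) x - (q x : ℂ) * y x

/-- `y` is a solution on `ℝ` of `τ_q(y) - l y = 0`. -/
structure IsSolution (q : ℝ → ℝ) (l : ℂ) (y : ℝ → ℂ) : Prop where
  regular : Regular y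
  eq : ∀ᵐ x, tau q y x - l * y x = 0

/-- `τ_q` is in the limit circle case at `+∞` and at `-∞`. -/
def LimitCircle (q : ℝ → ℝ) : Prop :=
  ∀ (l : ℂ) (y : ℝ → ℂ), IsSolution q l y →
    (∃ a : ℝ, MemLp y 2 (volume.restrict (Set.Ioi a))) ∧
    (∃ a : ℝ, MemLp y 2 (volume.restrict (Set.Iio a)))

/-- The maximal domain `D_max`, as a set of functions. -/
structure MaxDomain (q : ℝ → ℝ) (y : ℝ → ℂ) : Prop where
  regular : Regular y
  memLp : MemLp y 2 volume
  memLp_tau : MemLp (tau q y) 2 volume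

/-- `[f,g]_x = conj (f x) g'(x) - conj (f' x) g(x)`. -/
def bracket (f g : ℝ → ℂ) (x : ℝ) : ℂ :=
  star (f x) * deriv g x - star (deriv f x) * g x

/-- `w₁, w₂` are real valued solutions of `τ_q(y) = 0`, `w₁` is odd, `w₂` is even and
`[w₁,w₂]_{-∞} = [w₁,w₂]_∞ = 1`.  (Under `LimitCircle` they belong to `D_max`; that `[w_j,w_j]_{±∞}`
vanishes follows since they are real valued.) -/
structure IsSolutionPair (q : ℝ → ℝ) (w₁ w₂ : ℝ → ℂ) : Prop where
  solution₁ : IsSolution q 0 w₁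
  solution₂ : IsSolution q 0 w₂
  real₁ : ∀ x, (w₁ x).im = 0
  real₂ : ∀ x, (w₂ x).im = 0
  odd₁ : ∀ x, w₁ (-x) = -w₁ x
  even₂ : ∀ x, w₂ (-x) = w₂ x
  bracket_bot : Tendsto (bracket w₁ w₂) atBot (𝓝 1)
  bracket_top : Tendsto (bracket w₁ w₂) atTop (𝓝 1)

/-- `z = ((α₁(f), α₂(f)), (β₁(f), β₂(f)))`, where `α_j(f) = [w_j,f]_{-∞}`, `β_j(f) = [w_j,f]_∞`
are the limits of `[w_j,f]_x` as `x → -∞` and as `x → ∞`. -/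
structure HasBoundaryValues (w₁ w₂ f : ℝ → ℂ) (z : (Fin 2 → ℂ) × (Fin 2 → ℂ)) : Prop where
  alpha₁ : Tendsto (bracket w₁ f) atBot (𝓝 (z.1 0))
  alpha₂ : Tendsto (bracket w₂ f) atBot (𝓝 (z.1 1))
  beta₁ : Tendsto (bracket w₁ f) atTop (𝓝 (z.2 0))
  beta₂ : Tendsto (bracket w₂ f) atTop (𝓝 (z.2 1))

/-! ### Linearity and uniqueness facts needed for the definitions below -/

theorem LocAC.continuous {y : ℝ → ℂ} (h : LocAC y) : Continuous y := by
  rw [continuous_iff_continuousAt]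
  intro x
  refine (h (x - 1) (x + 1)).continuousOn.continuousAt ?_
  rw [Set.uIcc_of_le (by linarith)]
  exact Icc_mem_nhds (by linarith) (by linarith)

theorem Regular.locAC {y : ℝ → ℂ} (h : Regular y) : LocAC y := by
  intro a b
  have : ContDiff ℝ 1 y := contDiff_one_iff_deriv.2 ⟨h.differentiable, h.locAC_deriv.continuous⟩
  exact this.contDiffOn.absolutelyContinuousOnInterval

theorem LocAC.ae_differentiableAt {y : ℝ → ℂ} (h : LocAC y) :
    ∀ᵐ x : ℝ, DifferentiableAt ℝ y x := by
  refine LocallyBoundedVariationOn.ae_differentiableAt ?_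
  intro a b _ _
  refine (h a b).boundedVariationOn.mono ?_
  intro x hx
  exact Set.Icc_subset_uIcc hx.2

theorem Regular.zero : Regular (0 : ℝ → ℂ) := by
  have h0 : deriv (0 : ℝ → ℂ) = fun _ => 0 := by
    funext x
    exact deriv_const x (0 : ℂ)
  refine ⟨differentiable_const _, ?_⟩
  rw [h0]
  intro a b
  exact (contDiff_const (𝕜 := ℝ) (n := 1) (c := (0 : ℂ))).contDiffOn.absolutelyContinuousOnInterval

theorem Regular.deriv_add {y z : ℝ → ℂ} (hy : Regular y) (hz : Regular z) :
    deriv (y + z) = deriv y + deriv z := by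
  funext x
  exact _root_.deriv_add (hy.differentiable x) (hz.differentiable x)

theorem Regular.deriv_smul {y : ℝ → ℂ} (hy : Regular y) (c : ℂ) :
    deriv (c • y) = c • deriv y := by
  funext x
  exact ((hy.differentiable x).hasDerivAt.const_smul c).deriv

theorem Regular.add {y z : ℝ → ℂ} (hy : Regular y) (hz : Regular z) : Regular (y + z) := by
  refine ⟨hy.differentiable.add hz.differentiable, ?_⟩
  rw [hy.deriv_add hz]
  intro a b
  exact (hy.locAC_deriv a b).add (hz.locAC_deriv a b)

theorem Regular.smul {y : ℝ → ℂ} (hy : Regular y) (c : ℂ) : Regular (c • y) := by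
  refine ⟨hy.differentiable.const_smul c, ?_⟩
  rw [hy.deriv_smul]
  intro a b
  exact (hy.locAC_deriv a b).const_smul c

theorem tau_add {q : ℝ → ℝ} {y z : ℝ → ℂ} (hy : Regular y) (hz : Regular z) :
    tau q (y + z) =ᵐ[volume] tau q y + tau q z := by
  filter_upwards [hy.locAC_deriv.ae_differentiableAt, hz.locAC_deriv.ae_differentiableAt]
    with x h1 h2
  simp only [tau, hy.deriv_add hz, Pi.add_apply]
  rw [_root_.deriv_add h1 h2]
  ring

theorem tau_smul {q : ℝ → ℝ} {y : ℝ → ℂ} (hy : Regular y) (c : ℂ) :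
    tau q (c • y) =ᵐ[volume] c • tau q y := by
  filter_upwards [hy.locAC_deriv.ae_differentiableAt] with x h1
  simp only [tau, hy.deriv_smul, Pi.smul_apply, smul_eq_mul]
  rw [(h1.hasDerivAt.const_smul c).deriv, smul_eq_mul]
  ring

theorem MaxDomain.zero (q : ℝ → ℝ) : MaxDomain q (0 : ℝ → ℂ) := by
  refine ⟨Regular.zero, MemLp.zero, ?_⟩
  have h := tau_smul (q := q) Regular.zero (0 : ℂ)
  rw [zero_smul, zero_smul] at h
  exact MemLp.zero.ae_eq h.symm

theorem tau_zero (q : ℝ → ℝ) : tau q 0 =ᵐ[volume] 0 := by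
  have h := tau_smul (q := q) Regular.zero (0 : ℂ)
  rwa [zero_smul, zero_smul] at h

theorem MaxDomain.add {q : ℝ → ℝ} {y z : ℝ → ℂ} (hy : MaxDomain q y) (hz : MaxDomain q z) :
    MaxDomain q (y + z) :=
  ⟨hy.regular.add hz.regular, hy.memLp.add hz.memLp,
    (hy.memLp_tau.add hz.memLp_tau).ae_eq (tau_add hy.regular hz.regular).symm⟩

theorem MaxDomain.smul {q : ℝ → ℝ} {y : ℝ → ℂ} (hy : MaxDomain q y) (c : ℂ) :
    MaxDomain q (c • y) :=
  ⟨hy.regular.smul c, hy.memLp.const_smul c,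
    (hy.memLp_tau.const_smul c).ae_eq (tau_smul hy.regular c).symm⟩

theorem bracket_add {w y z : ℝ → ℂ} (hy : Regular y) (hz : Regular z) :
    bracket w (y + z) = bracket w y + bracket w z := by
  funext x
  simp only [bracket, hy.deriv_add hz, Pi.add_apply]
  ring

theorem bracket_smul {w y : ℝ → ℂ} (hy : Regular y) (c : ℂ) :
    bracket w (c • y) = c • bracket w y := by
  funext x
  simp only [bracket, hy.deriv_smul, Pi.smul_apply, smul_eq_mul]
  ring

theorem bracket_zero (w : ℝ → ℂ) : bracket w 0 = 0 := by
  have h := bracket_smul (w := w) Regular.zero (0 : ℂ)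
  rwa [zero_smul, zero_smul] at h

/-! ### The operators -/

/-- The graph of the maximal operator. -/
def maxGraph (q : ℝ → ℝ) : Submodule ℂ (L2 × L2) where
  carrier := {p | ∃ y : ℝ → ℂ, MaxDomain q y ∧ p.1 =ᵐ[volume] y ∧ p.2 =ᵐ[volume] tau q y}
  zero_mem' := ⟨0, MaxDomain.zero q, Lp.coeFn_zero _ _ _,
    (Lp.coeFn_zero ℂ 2 volume).trans (tau_zero q).symm⟩
  add_mem' := by
    rintro ⟨u, u'⟩ ⟨v, v'⟩ ⟨y, hy, hu, hu'⟩ ⟨z, hz, hv, hv'⟩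
    exact ⟨y + z, hy.add hz, (Lp.coeFn_add u v).trans (hu.add hv),
      ((Lp.coeFn_add u' v').trans (hu'.add hv')).trans (tau_add hy.regular hz.regular).symm⟩
  smul_mem' := by
    rintro c ⟨u, u'⟩ ⟨y, hy, hu, hu'⟩
    exact ⟨c • y, hy.smul c, (Lp.coeFn_smul c u).trans (hu.const_smul c),
      ((Lp.coeFn_smul c u').trans (hu'.const_smul c)).trans (tau_smul hy.regular c).symm⟩

/-- The maximal operator `A_max`: domain `D_max`, `A_max y = τ_q(y)`. -/
def maxOp (q : ℝ → ℝ) : L2 →ₗ.[ℂ] L2 := (maxGraph q).toLinearPMap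

/-- `maxGraph` is the graph of an operator, so that `maxOp` does not take a default value. -/
theorem maxOp_graph (q : ℝ → ℝ) : (maxOp q).graph = maxGraph q := by
  refine Submodule.toLinearPMap_graph_eq _ ?_
  rintro ⟨u, u'⟩ ⟨y, hy, hu, hu'⟩ h0
  simp only at h0 hu hu' ⊢
  subst h0
  have hy0 : y = 0 := by
    refine (Continuous.ae_eq_iff_eq volume hy.regular.differentiable.continuous
      continuous_zero).1 ?_
    exact hu.symm.trans (Lp.coeFn_zero _ _ _)
  subst hy0
  exact (Lp.eq_zero_iff_ae_eq_zero).2 (hu'.trans (tau_zero q))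

/-- The elements of `D_max` whose boundary values lie in the subspace `B` of `ℂ² × ℂ²`. -/
def boundaryDomain (q : ℝ → ℝ) (w₁ w₂ : ℝ → ℂ) (B : Submodule ℂ ((Fin 2 → ℂ) × (Fin 2 → ℂ))) :
    Submodule ℂ L2 where
  carrier := {u | ∃ y : ℝ → ℂ, MaxDomain q y ∧ u =ᵐ[volume] y ∧
    ∃ z ∈ B, HasBoundaryValues w₁ w₂ y z}
  zero_mem' := by
    refine ⟨0, MaxDomain.zero q, Lp.coeFn_zero _ _ _, 0, B.zero_mem, ?_⟩
    constructor <;> rw [bracket_zero] <;> exact tendsto_const_nhds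
  add_mem' := by
    rintro u v ⟨y, hy, hu, z, hz, h⟩ ⟨y', hy', hv, z', hz', h'⟩
    refine ⟨y + y', hy.add hy', (Lp.coeFn_add u v).trans (hu.add hv), z + z',
      B.add_mem hz hz', ?_⟩
    constructor <;> rw [bracket_add hy.regular hy'.regular]
    exacts [h.alpha₁.add h'.alpha₁, h.alpha₂.add h'.alpha₂, h.beta₁.add h'.beta₁,
      h.beta₂.add h'.beta₂]
  smul_mem' := by
    rintro c u ⟨y, hy, hu, z, hz, h⟩
    refine ⟨c • y, hy.smul c, (Lp.coeFn_smul c u).trans (hu.const_smul c), c • z,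
      B.smul_mem c hz, ?_⟩
    constructor <;> rw [bracket_smul hy.regular]
    exacts [h.alpha₁.const_smul c, h.alpha₂.const_smul c, h.beta₁.const_smul c,
      h.beta₂.const_smul c]

/-- The extension `Ã`: the restriction of `A_max` to the functions in `D_max` with boundary values
in `B`. -/
def extension (q : ℝ → ℝ) (w₁ w₂ : ℝ → ℂ) (B : Submodule ℂ ((Fin 2 → ℂ) × (Fin 2 → ℂ))) :
    L2 →ₗ.[ℂ] L2 :=
  (maxOp q).domRestrict (boundaryDomain q w₁ w₂ B)

/-! ### The boundary conditions -/

/-- Separated boundary conditions `a α₁ + b α₂ = 0`, `c β₁ + d β₂ = 0`. -/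
def separatedBC (a b c d : ℂ) : Submodule ℂ ((Fin 2 → ℂ) × (Fin 2 → ℂ)) where
  carrier := {z | a * z.1 0 + b * z.1 1 = 0 ∧ c * z.2 0 + d * z.2 1 = 0}
  zero_mem' := by simp
  add_mem' := by
    rintro z z' ⟨h1, h2⟩ ⟨h1', h2'⟩
    refine ⟨?_, ?_⟩ <;> simp only [Prod.fst_add, Prod.snd_add, Pi.add_apply]
    · linear_combination h1 + h1'
    · linear_combination h2 + h2'
  smul_mem' := by
    rintro t z ⟨h1, h2⟩
    refine ⟨?_, ?_⟩ <;> simp only [Prod.smul_fst, Prod.smul_snd, Pi.smul_apply, smul_eq_mul]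
    · linear_combination t * h1
    · linear_combination t * h2

/-- Separated boundary conditions `α₁ ξ cos α - α₂ sin α = 0`, `β₁ η cos β - β₂ sin β = 0`. -/
def normSeparatedBC (ξ η : ℂ) (α β : ℝ) : Submodule ℂ ((Fin 2 → ℂ) × (Fin 2 → ℂ)) :=
  separatedBC (ξ * (Real.cos α : ℂ)) (-(Real.sin α : ℂ))
    (η * (Real.cos β : ℂ)) (-(Real.sin β : ℂ))

/-- Mixed boundary conditions `(α₁, α₂)ᵀ = M (β₁, β₂)ᵀ`. -/
def mixedBC₁ (M : Matrix (Fin 2) (Fin 2) ℂ) : Submodule ℂ ((Fin 2 → ℂ) × (Fin 2 → ℂ)) where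
  carrier := {z | z.1 = M.mulVec z.2}
  zero_mem' := (Matrix.mulVec_zero M).symm
  add_mem' := by
    rintro z z' (h : z.1 = _) (h' : z'.1 = _)
    show (z + z').1 = M.mulVec (z + z').2
    rw [Prod.fst_add, Prod.snd_add, Matrix.mulVec_add, h, h']
  smul_mem' := by
    rintro t z (h : z.1 = _)
    show (t • z).1 = M.mulVec (t • z).2
    rw [Prod.smul_fst, Prod.smul_snd, Matrix.mulVec_smul, h]

/-- Mixed boundary conditions `(β₁, β₂)ᵀ = M (α₁, α₂)ᵀ`. -/
def mixedBC₂ (M : Matrix (Fin 2) (Fin 2) ℂ) : Submodule ℂ ((Fin 2 → ℂ) × (Fin 2 → ℂ)) where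
  carrier := {z | z.2 = M.mulVec z.1}
  zero_mem' := (Matrix.mulVec_zero M).symm
  add_mem' := by
    rintro z z' (h : z.2 = _) (h' : z'.2 = _)
    show (z + z').2 = M.mulVec (z + z').1
    rw [Prod.fst_add, Prod.snd_add, Matrix.mulVec_add, h, h']
  smul_mem' := by
    rintro t z (h : z.2 = _)
    show (t • z).2 = M.mulVec (t • z).1
    rw [Prod.smul_fst, Prod.smul_snd, Matrix.mulVec_smul, h]

/-- The pair `(ξ, α)` is normalized: `ξ = 1` where the condition does not determine `ξ` up to sign
(that is, where `cos α = 0` or `sin α = 0`), and `ξ ≠ -1` (note that `(-ξ, 2π - α)` gives the same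
condition as `(ξ, α)`). -/
def Normalized (ξ : ℂ) (α : ℝ) : Prop :=
  (Real.sin α * Real.cos α = 0 → ξ = 1) ∧ ξ ≠ -1

/-- For some real `φ`: `Δ = ad - bc = e^{2iφ}` and `e^{-iφ}a, e^{-iφ}b, e^{-iφ}c, e^{-iφ}d` are
real. -/
def MixedCriterion (a b c d : ℂ) : Prop :=
  ∃ φ : ℝ, a * d - b * c = Complex.exp (2 * Complex.I * φ) ∧
    (∃ r : ℝ, Complex.exp (-Complex.I * φ) * a = r) ∧
    (∃ r : ℝ, Complex.exp (-Complex.I * φ) * b = r) ∧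
    (∃ r : ℝ, Complex.exp (-Complex.I * φ) * c = r) ∧
    (∃ r : ℝ, Complex.exp (-Complex.I * φ) * d = r)

end SturmLiouville

end

/-!
By Green's formula, the difference of `⟨τ_q f, g⟩` and `⟨f, τ_q g⟩` is `[f, g]_∞ - [f, g]_{-∞}`.
Since `[w₁, w₂] = 1` identically, every bracket can be expressed as
`[f, g] = conj [w₁, f] [w₂, g] - conj [w₂, f] [w₁, g]`, so that this difference is a nondegenerate
sesquilinear form in the boundary values of `f` and `g`.

Variation of constants solves `τ_q y = F` in `L²` with vanishing boundary values at `-∞`; those at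
`∞` are then, up to sign, the inner products of `F` with `w₁` and `w₂`. This has two consequences.
Every element of `ℂ² × ℂ²` is the boundary value of some `y ∈ D_max`, and, as `span {w₁, w₂}` is
finite dimensional and hence equal to its double orthogonal complement, the adjoint of an extension
`Ã` is a restriction of `A_max`. By Green's formula, the adjoint of the extension with boundary
space `B` is therefore the one with boundary space `B^⊥`, and `Ã = Ã*` if and only if `B = B^⊥`.

What remains is linear algebra in `ℂ²`: the orthogonal complement of a line is the conjugate line,
and that of the graph of a matrix `M` is the transposed graph of the adjugate of `conj M`. For
mixed conditions self-adjointness thus means `adj (conj M) M = 1`, that is, `|det M| = 1` and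
`M = det M • conj M`; writing `det M = e^{2iφ}`, this says that `e^{-iφ} M` is real.
-/

noncomputable section

namespace SturmLiouville

/-! ### Absolute continuity -/

section AbsolutelyContinuous

variable {X Y E : Type*} [PseudoMetricSpace X] [PseudoMetricSpace Y]
  [NormedAddCommGroup E] [NormedSpace ℝ E] {a b c : ℝ}

theorem absolutelyContinuousOnInterval_of_dist_le {f : ℝ → X} {g : ℝ → Y}
    (hg : AbsolutelyContinuousOnInterval g a b)
    (h : ∀ x ∈ Set.uIcc a b, ∀ y ∈ Set.uIcc a b, dist (f x) (f y) ≤ dist (g x) (g y)) :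
    AbsolutelyContinuousOnInterval f a b := by
  rw [absolutelyContinuousOnInterval_iff] at hg ⊢
  intro ε hε
  obtain ⟨δ, hδ, hgδ⟩ := hg ε hε
  refine ⟨δ, hδ, fun E hE hEδ => lt_of_le_of_lt (Finset.sum_le_sum fun i hi => ?_) (hgδ E hE hEδ)⟩
  obtain ⟨hleft, hright⟩ := hE.1 i hi
  exact h _ hleft _ hright

theorem absolutelyContinuousOnInterval_intervalIntegral {g : ℝ → E}
    (hg : IntervalIntegrable g volume a b) (hc : c ∈ Set.uIcc a b) :
    AbsolutelyContinuousOnInterval (fun x => ∫ t in c..x, g t) a b := by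
  have hint : ∀ x ∈ Set.uIcc a b, IntervalIntegrable g volume c x := fun x hx =>
    hg.mono_set (Set.uIcc_subset_uIcc hc hx)
  refine absolutelyContinuousOnInterval_of_dist_le
    (hg.norm.absolutelyContinuousOnInterval_intervalIntegral hc) fun x hx y hy => ?_
  rw [dist_eq_norm, dist_eq_norm, intervalIntegral.integral_interval_sub_left (hint x hx)
    (hint y hy), intervalIntegral.integral_interval_sub_left (hint x hx).norm (hint y hy).norm,
    Real.norm_eq_abs]
  exact intervalIntegral.norm_integral_le_abs_integral_norm

theorem setIntegral_Iic_eq_add {g : ℝ → E} (hg : Integrable g volume) (x y : ℝ) :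
    ∫ t in Set.Iic y, g t = (∫ t in Set.Iic x, g t) + ∫ t in x..y, g t := by
  rw [← intervalIntegral.integral_Iic_sub_Iic hg.integrableOn hg.integrableOn, add_sub_cancel]

theorem absolutelyContinuousOnInterval_setIntegral_Iic {g : ℝ → E} (hg : Integrable g volume)
    (a b : ℝ) : AbsolutelyContinuousOnInterval (fun x => ∫ t in Set.Iic x, g t) a b :=
  absolutelyContinuousOnInterval_of_dist_le
    (absolutelyContinuousOnInterval_intervalIntegral hg.intervalIntegrable Set.left_mem_uIcc)
    fun x _ y _ => by
      rw [setIntegral_Iic_eq_add hg a x, setIntegral_Iic_eq_add hg a y, dist_add_left]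

theorem norm_setIntegral_le_integral_norm {α : Type*} [MeasurableSpace α] {μ : Measure α}
    {g : α → E} (hg : Integrable g μ) (s : Set α) : ‖∫ t in s, g t ∂μ‖ ≤ ∫ t, ‖g t‖ ∂μ :=
  (norm_integral_le_integral_norm g).trans
    (setIntegral_le_integral hg.norm (Eventually.of_forall fun t => norm_nonneg (g t)))

theorem tendsto_setIntegral_Iic_atTop {g : ℝ → E} (hg : Integrable g volume) :
    Tendsto (fun x => ∫ t in Set.Iic x, g t) atTop (𝓝 (∫ t, g t)) :=
  (aecover_Iic tendsto_id).integral_tendsto_of_countably_generated hg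

variable [CompleteSpace E]

theorem ae_hasDerivAt_setIntegral_Iic {g : ℝ → E} (hg : Integrable g volume) :
    ∀ᵐ x, HasDerivAt (fun x => ∫ t in Set.Iic x, g t) (g x) x := by
  filter_upwards [LocallyIntegrable.ae_hasDerivAt_integral hg.locallyIntegrable] with x hx
  rw [funext (setIntegral_Iic_eq_add hg 0)]
  exact (hx 0).const_add _

theorem intervalIntegral_eq_sub_of_ae_hasDerivAt {f g : ℝ → E}
    (hf : AbsolutelyContinuousOnInterval f a b) (hg : IntervalIntegrable g volume a b)
    (h : ∀ᵐ x, x ∈ Set.uIcc a b → HasDerivAt f (g x) x) : ∫ t in a..b, g t = f b - f a := by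
  obtain ⟨C, hC⟩ := (hf.sub (absolutelyContinuousOnInterval_intervalIntegral hg
    Set.left_mem_uIcc)).const_of_ae_hasDerivAt_zero (by
      filter_upwards [h, hg.ae_hasDerivAt_integral] with x hfx hgx hx
      simpa only [sub_self] using (hfx hx).sub (hgx hx a Set.left_mem_uIcc))
  have ha : f a - ∫ t in a..a, g t = C := hC a Set.left_mem_uIcc
  have hb : f b - ∫ t in a..b, g t = C := hC b Set.right_mem_uIcc
  rw [intervalIntegral.integral_same, sub_zero] at ha
  rw [ha, ← hb, sub_sub_cancel]

end AbsolutelyContinuous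

section LocAC

variable {f g : ℝ → ℂ}

theorem LocAC.sub (hf : LocAC f) (hg : LocAC g) : LocAC fun x => f x - g x :=
  fun a b => (hf a b).sub (hg a b)

theorem LocAC.mul (hf : LocAC f) (hg : LocAC g) : LocAC fun x => f x * g x :=
  fun a b => (hf a b).smul (hg a b)

theorem LocAC.star (hf : LocAC f) : LocAC fun x => star (f x) := fun a b =>
  absolutelyContinuousOnInterval_of_dist_le (hf a b) fun x _ y _ =>
    (dist_star_star (f x) (f y)).le

theorem LocAC.intervalIntegral_eq_sub (hf : LocAC f) (hg : LocallyIntegrable g volume)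
    (h : ∀ᵐ x, HasDerivAt f (g x) x) (a b : ℝ) : ∫ t in a..b, g t = f b - f a :=
  intervalIntegral_eq_sub_of_ae_hasDerivAt (hf a b)
    (hg.integrableOn_isCompact isCompact_uIcc).intervalIntegrable
    (h.mono fun _ hx _ => hx)

theorem LocAC.hasDerivAt (hf : LocAC f) (hg : Continuous g) (h : ∀ᵐ x, HasDerivAt f (g x) x)
    (x : ℝ) : HasDerivAt f (g x) x := by
  have hprim : f = fun y => (∫ t in (0 : ℝ)..y, g t) + f 0 := by
    funext y
    rw [hf.intervalIntegral_eq_sub hg.locallyIntegrable h 0 y, sub_add_cancel]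
  rw [hprim]
  exact (hg.integral_hasStrictDerivAt 0 x).hasDerivAt.add_const _

theorem LocAC.exists_tendsto (hf : LocAC f) (hg : Integrable g volume)
    (h : ∀ᵐ x, HasDerivAt f (g x) x) :
    ∃ l, Tendsto f atBot (𝓝 l) ∧ Tendsto f atTop (𝓝 (l + ∫ t, g t)) := by
  set l := f 0 - ∫ t in Set.Iic (0 : ℝ), g t with hl
  have hprim : (fun x => l + ∫ t in Set.Iic x, g t) = f := by
    funext x
    rw [setIntegral_Iic_eq_add hg 0 x, hf.intervalIntegral_eq_sub hg.locallyIntegrable h, hl]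
    ring
  refine ⟨l, ?_, ?_⟩ <;> rw [← hprim]
  · simpa only [add_zero, id_eq] using (tendsto_integral_Iic_zero tendsto_id).const_add l
  · exact (tendsto_setIntegral_Iic_atTop hg).const_add l

end LocAC

/-! ### The boundary form -/

section PlaneForm

/-- The sesquilinear symplectic form `(u, v) ↦ ū₀ v₁ - ū₁ v₀` on the plane; the bracket
`[f, g]_x` is its value at `(f(x), f'(x))` and `(g(x), g'(x))`. -/
def planeForm {R : Type*} [CommRing R] [StarRing R] :
    (Fin 2 → R) →ₗ⋆[R] (Fin 2 → R) →ₗ[R] R :=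
  LinearMap.mk₂'ₛₗ (starRingEnd R) (RingHom.id R)
    (fun u v => star (u 0) * v 1 - star (u 1) * v 0)
    (fun u u' v => by simp only [Pi.add_apply, star_add]; ring)
    (fun c u v => by
      simp only [Pi.smul_apply, smul_eq_mul, star_mul', starRingEnd_apply]; ring)
    (fun u v v' => by simp only [Pi.add_apply]; ring)
    (fun c u v => by simp only [Pi.smul_apply, smul_eq_mul, RingHom.id_apply]; ring)

section CommRing

variable {R : Type*} [CommRing R] [StarRing R]

theorem planeForm_apply (u v : Fin 2 → R) :
    planeForm u v = star (u 0) * v 1 - star (u 1) * v 0 := rfl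

theorem separatingRight_planeForm : (planeForm (R := R)).SeparatingRight := by
  intro v hv
  have h0 := hv ![1, 0]
  have h1 := hv ![0, 1]
  simp only [planeForm_apply, Matrix.cons_val_zero, Matrix.cons_val_one, star_one, star_zero,
    one_mul, zero_mul, sub_zero, zero_sub, neg_eq_zero] at h0 h1
  ext i
  fin_cases i
  exacts [h1, h0]

/-- The adjoint of the matrix `M` with respect to `planeForm`, see `planeForm_mulVec_left`. -/
def formAdjoint (M : Matrix (Fin 2) (Fin 2) R) : Matrix (Fin 2) (Fin 2) R :=
  (M.map star).adjugate

theorem planeForm_mulVec_left (M : Matrix (Fin 2) (Fin 2) R) (u v : Fin 2 → R) :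
    planeForm (M.mulVec u) v = planeForm u ((formAdjoint M).mulVec v) := by
  simp only [planeForm_apply, formAdjoint, Matrix.adjugate_fin_two, Matrix.mulVec, dotProduct,
    Fin.sum_univ_two, Matrix.map_apply, Matrix.of_apply, Matrix.cons_val', Matrix.cons_val_zero,
    Matrix.cons_val_one, Matrix.cons_val_fin_one, star_add, star_mul']
  ring

theorem det_map_star (M : Matrix (Fin 2) (Fin 2) R) : (M.map star).det = star M.det := by
  simp only [Matrix.det_fin_two, Matrix.map_apply, star_sub, star_mul']

theorem formAdjoint_mul_self_eq_one_iff {M : Matrix (Fin 2) (Fin 2) R} :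
    formAdjoint M * M = 1 ↔ star M.det * M.det = 1 ∧ M = M.det • M.map star := by
  constructor
  · intro h
    have hdet : star M.det * M.det = 1 := by
      simpa [formAdjoint, Matrix.det_adjugate, det_map_star] using congrArg Matrix.det h
    have hM : star M.det • M = M.map star := by
      rw [← det_map_star, ← Matrix.one_mul M, ← Matrix.smul_mul, ← Matrix.mul_adjugate,
        Matrix.mul_assoc, Matrix.one_mul, ← formAdjoint, h, Matrix.mul_one]
    refine ⟨hdet, ?_⟩
    rw [← hM, smul_smul, mul_comm, hdet, one_smul]
  · rintro ⟨hdet, hM⟩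
    rw [formAdjoint]
    nth_rewrite 2 [hM]
    rw [Matrix.mul_smul, Matrix.adjugate_mul, det_map_star, smul_smul, mul_comm, hdet, one_smul]

end CommRing

theorem forall_planeForm_eq_zero_iff {K : Type*} [Field K] [StarRing K] {a b : K}
    (hab : a ≠ 0 ∨ b ≠ 0) {v : Fin 2 → K} :
    (∀ u : Fin 2 → K, a * u 0 + b * u 1 = 0 → planeForm u v = 0) ↔
      star a * v 0 + star b * v 1 = 0 := by
  constructor
  · intro h
    have hv := h ![b, -a] (by
      simp only [Matrix.cons_val_zero, Matrix.cons_val_one, mul_neg]; ring)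
    simp only [planeForm_apply, Matrix.cons_val_zero, Matrix.cons_val_one, star_neg] at hv
    linear_combination hv
  · intro hv u hu
    have hu' : star a * star (u 0) + star b * star (u 1) = 0 := by
      rw [← star_mul', ← star_mul', ← star_add, hu, star_zero]
    rw [planeForm_apply]
    rcases hab with ha | hb
    · refine (mul_eq_zero.1 ?_).resolve_left (star_ne_zero.2 ha)
      linear_combination v 1 * hu' - star (u 1) * hv
    · refine (mul_eq_zero.1 ?_).resolve_left (star_ne_zero.2 hb)
      linear_combination star (u 0) * hv - v 0 * hu'

end PlaneForm

/-- The space of boundary values `((α₁, α₂), (β₁, β₂))`, at `-∞` and at `+∞`. -/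
abbrev BoundarySpace : Type := (Fin 2 → ℂ) × (Fin 2 → ℂ)

/-- The sesquilinear form on boundary values given by the boundary terms of Green's formula. -/
def boundaryForm : BoundarySpace →ₗ⋆[ℂ] BoundarySpace →ₗ[ℂ] ℂ :=
  (planeForm.comp (LinearMap.snd ℂ _ _)).compl₂ (LinearMap.snd ℂ _ _) -
    (planeForm.comp (LinearMap.fst ℂ _ _)).compl₂ (LinearMap.fst ℂ _ _)

theorem boundaryForm_apply (z z' : BoundarySpace) :
    boundaryForm z z' = planeForm z.2 z'.2 - planeForm z.1 z'.1 := rfl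

theorem orthogonalBilin_separatedBC {a b c d : ℂ} (hab : a ≠ 0 ∨ b ≠ 0) (hcd : c ≠ 0 ∨ d ≠ 0) :
    (separatedBC a b c d).orthogonalBilin boundaryForm =
      separatedBC (star a) (star b) (star c) (star d) := by
  ext z
  change (∀ z', _ ∧ _ → boundaryForm z' z = 0) ↔ _ ∧ _
  rw [← forall_planeForm_eq_zero_iff hab, ← forall_planeForm_eq_zero_iff hcd]
  constructor
  · refine fun h => ⟨fun u hu => ?_, fun u hu => ?_⟩
    · simpa [boundaryForm_apply] using h (u, 0) ⟨hu, by simp⟩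
    · simpa [boundaryForm_apply] using h (0, u) ⟨by simp, hu⟩
  · rintro ⟨hbot, htop⟩ z' ⟨hz'₁, hz'₂⟩
    rw [boundaryForm_apply, hbot _ hz'₁, htop _ hz'₂, sub_zero]

theorem separatedBC_le_iff {a b c d a' b' c' d' : ℂ} (hab : a ≠ 0 ∨ b ≠ 0)
    (hcd : c ≠ 0 ∨ d ≠ 0) :
    separatedBC a b c d ≤ separatedBC a' b' c' d' ↔ a * b' = a' * b ∧ c * d' = c' * d := by
  have mul_add_mul_eq_zero {a b a' b' : ℂ} (hab : a ≠ 0 ∨ b ≠ 0) (h : a * b' = a' * b)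
      {u : Fin 2 → ℂ} (hu : a * u 0 + b * u 1 = 0) : a' * u 0 + b' * u 1 = 0 := by
    rcases hab with ha | hb
    · refine (mul_eq_zero.1 ?_).resolve_left ha
      linear_combination a' * hu + u 1 * h
    · refine (mul_eq_zero.1 ?_).resolve_left hb
      linear_combination b' * hu - u 0 * h
  constructor
  · intro h
    have hmem : ((![b, -a], ![d, -c]) : BoundarySpace) ∈ separatedBC a b c d := by
      constructor <;> simp only [Matrix.cons_val_zero, Matrix.cons_val_one] <;> ring
    obtain ⟨hbot, htop⟩ := h hmem
    simp only [Matrix.cons_val_zero, Matrix.cons_val_one] at hbot htop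
    exact ⟨by linear_combination -hbot, by linear_combination -htop⟩
  · rintro ⟨hbot, htop⟩ z ⟨hz₁, hz₂⟩
    exact ⟨mul_add_mul_eq_zero hab hbot hz₁, mul_add_mul_eq_zero hcd htop hz₂⟩

theorem separatedBC_eq_iff {a b c d a' b' c' d' : ℂ} (hab : a ≠ 0 ∨ b ≠ 0) (hcd : c ≠ 0 ∨ d ≠ 0)
    (hab' : a' ≠ 0 ∨ b' ≠ 0) (hcd' : c' ≠ 0 ∨ d' ≠ 0) :
    separatedBC a b c d = separatedBC a' b' c' d' ↔ a * b' = a' * b ∧ c * d' = c' * d := by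
  rw [le_antisymm_iff, separatedBC_le_iff hab hcd, separatedBC_le_iff hab' hcd',
    and_iff_left_iff_imp]
  exact fun ⟨hbot, htop⟩ => ⟨hbot.symm, htop.symm⟩

theorem orthogonalBilin_mixedBC₁ (M : Matrix (Fin 2) (Fin 2) ℂ) :
    (mixedBC₁ M).orthogonalBilin boundaryForm = mixedBC₂ (formAdjoint M) := by
  ext z
  have hgraph : z ∈ (mixedBC₁ M).orthogonalBilin boundaryForm ↔
      ∀ u, planeForm u (z.2 - (formAdjoint M).mulVec z.1) = 0 := by
    refine ⟨fun h u => ?_, fun h z' hz' => ?_⟩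
    · rw [map_sub, ← planeForm_mulVec_left]
      exact h (M.mulVec u, u) rfl
    · change boundaryForm z' z = 0
      rw [boundaryForm_apply, show z'.1 = _ from hz', planeForm_mulVec_left, ← map_sub, h]
  rw [hgraph]
  refine ⟨fun h => sub_eq_zero.1 (separatingRight_planeForm _ h), fun h u => ?_⟩
  rw [sub_eq_zero.2 (show z.2 = _ from h), map_zero]

theorem orthogonalBilin_mixedBC₂ (M : Matrix (Fin 2) (Fin 2) ℂ) :
    (mixedBC₂ M).orthogonalBilin boundaryForm = mixedBC₁ (formAdjoint M) := by
  ext z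
  have hgraph : z ∈ (mixedBC₂ M).orthogonalBilin boundaryForm ↔
      ∀ u, planeForm u ((formAdjoint M).mulVec z.2 - z.1) = 0 := by
    refine ⟨fun h u => ?_, fun h z' hz' => ?_⟩
    · rw [map_sub, ← planeForm_mulVec_left]
      exact h (u, M.mulVec u) rfl
    · change boundaryForm z' z = 0
      rw [boundaryForm_apply, show z'.2 = _ from hz', planeForm_mulVec_left, ← map_sub, h]
  rw [hgraph]
  refine ⟨fun h => (sub_eq_zero.1 (separatingRight_planeForm _ h)).symm, fun h u => ?_⟩
  rw [sub_eq_zero.2 (show z.1 = _ from h).symm, map_zero]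

theorem mixedBC₂_eq_mixedBC₁_iff {M N : Matrix (Fin 2) (Fin 2) ℂ} :
    mixedBC₂ N = mixedBC₁ M ↔ N * M = 1 := by
  constructor
  · intro h
    refine Matrix.ext_of_mulVec_single fun i => ?_
    have hmem : (M.mulVec (Pi.single i 1), Pi.single i 1) ∈ mixedBC₂ N := by
      rw [h]
      rfl
    rw [← Matrix.mulVec_mulVec, Matrix.one_mulVec]
    exact (show _ = N.mulVec _ from hmem).symm
  · intro h
    ext z
    change z.2 = N.mulVec z.1 ↔ z.1 = M.mulVec z.2
    constructor <;> intro hz <;> rw [hz, Matrix.mulVec_mulVec]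
    · rw [mul_eq_one_comm.1 h, Matrix.one_mulVec]
    · rw [h, Matrix.one_mulVec]

/-! ### Green's formula -/

theorem inner_toLp {α : Type*} [MeasurableSpace α] {μ : Measure α} {f g : α → ℂ}
    (hf : MemLp f 2 μ) (hg : MemLp g 2 μ) :
    inner ℂ (hf.toLp f) (hg.toLp g) = ∫ x, star (f x) * g x ∂μ := by
  rw [L2.inner_def]
  refine integral_congr_ae ?_
  filter_upwards [hf.coeFn_toLp, hg.coeFn_toLp] with x hfx hgx
  rw [hfx, hgx, RCLike.inner_apply', RCLike.star_def]

variable {q : ℝ → ℝ} {f g y : ℝ → ℂ}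

theorem locAC_bracket (hf : Regular f) (hg : Regular g) : LocAC (bracket f g) :=
  (hf.locAC.star.mul hg.locAC_deriv).sub (hf.locAC_deriv.star.mul hg.locAC)

theorem ae_hasDerivAt_bracket (q : ℝ → ℝ) (hf : Regular f) (hg : Regular g) :
    ∀ᵐ x, HasDerivAt (bracket f g) (star (tau q f x) * g x - star (f x) * tau q g x) x := by
  filter_upwards [hf.locAC_deriv.ae_differentiableAt, hg.locAC_deriv.ae_differentiableAt]
    with x hf' hg'
  have hbracket := ((hf.differentiable x).hasDerivAt.star.mul hg'.hasDerivAt).sub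
    (hf'.hasDerivAt.star.mul (hg.differentiable x).hasDerivAt)
  refine hbracket.congr_deriv ?_
  simp only [tau, RCLike.star_def, map_sub, map_neg, map_mul, Complex.conj_ofReal]
  ring

/-- The point `(y, τ_q(y))` of the graph of the maximal operator given by `y ∈ D_max`. -/
def MaxDomain.graphPoint (hy : MaxDomain q y) : L2 × L2 :=
  (hy.memLp.toLp y, hy.memLp_tau.toLp (tau q y))

theorem mem_maxGraph_iff {p : L2 × L2} :
    p ∈ maxGraph q ↔ ∃ y, ∃ hy : MaxDomain q y, p = hy.graphPoint := by
  constructor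
  · rintro ⟨y, hy, h₁, h₂⟩
    exact ⟨y, hy, Prod.ext (Lp.ext (h₁.trans hy.memLp.coeFn_toLp.symm))
      (Lp.ext (h₂.trans hy.memLp_tau.coeFn_toLp.symm))⟩
  · rintro ⟨y, hy, rfl⟩
    exact ⟨y, hy, hy.memLp.coeFn_toLp, hy.memLp_tau.coeFn_toLp⟩

theorem MaxDomain.eq_of_ae_eq (hf : MaxDomain q f) (hg : MaxDomain q g) (h : f =ᵐ[volume] g) :
    f = g :=
  (Continuous.ae_eq_iff_eq volume hf.regular.locAC.continuous hg.regular.locAC.continuous).1 h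

theorem MaxDomain.eq_of_graphPoint_fst_eq (hf : MaxDomain q f) (hg : MaxDomain q g)
    (h : hf.graphPoint.1 = hg.graphPoint.1) : f = g :=
  hf.eq_of_ae_eq hg ((MemLp.toLp_eq_toLp_iff hf.memLp hg.memLp).1 h)

theorem MaxDomain.exists_tendsto_bracket (hf : MaxDomain q f) (hg : MaxDomain q g) :
    ∃ l, Tendsto (bracket f g) atBot (𝓝 l) ∧ Tendsto (bracket f g) atTop
      (𝓝 (l + (inner ℂ hf.graphPoint.2 hg.graphPoint.1 -
        inner ℂ hf.graphPoint.1 hg.graphPoint.2))) := by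
  have hτ : Integrable (fun x => star (tau q f x) * g x) volume :=
    hf.memLp_tau.star.integrable_mul hg.memLp
  have hτ' : Integrable (fun x => star (f x) * tau q g x) volume :=
    hf.memLp.star.integrable_mul hg.memLp_tau
  rw [MaxDomain.graphPoint, MaxDomain.graphPoint, inner_toLp, inner_toLp, ← integral_sub hτ hτ']
  exact (locAC_bracket hf.regular hg.regular).exists_tendsto (hτ.sub hτ')
    (ae_hasDerivAt_bracket q hf.regular hg.regular)

/-! ### Boundary values with respect to a pair of square integrable solutions -/

theorem IsSolution.tau_ae_eq_zero (h : IsSolution q 0 y) : tau q y =ᵐ[volume] 0 := by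
  filter_upwards [h.eq] with x hx
  simpa only [zero_mul, sub_zero, Pi.zero_apply] using hx

theorem IsSolution.maxDomain (h : IsSolution q 0 y) (hy : MemLp y 2 volume) : MaxDomain q y :=
  ⟨h.regular, hy, MemLp.zero.ae_eq h.tau_ae_eq_zero.symm⟩

theorem IsSolution.bracket_eq_bracket (hf : IsSolution q 0 f) (hg : IsSolution q 0 g) (a b : ℝ) :
    bracket f g a = bracket f g b := by
  have hderiv := (locAC_bracket hf.regular hg.regular).hasDerivAt (g := fun _ => 0)
    continuous_const (by
      filter_upwards [ae_hasDerivAt_bracket q hf.regular hg.regular, hf.tau_ae_eq_zero,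
        hg.tau_ae_eq_zero] with x hx hfx hgx
      simpa [hfx, hgx] using hx)
  exact is_const_of_deriv_eq_zero (fun x => (hderiv x).differentiableAt)
    (fun x => (hderiv x).deriv) a b

theorem memLp_two_of_memLp_Ioi_of_memLp_Iio {E : Type*} [NormedAddCommGroup E] {y : ℝ → E}
    {a b : ℝ} (hy : Continuous y) (ha : MemLp y 2 (volume.restrict (Set.Ioi a)))
    (hb : MemLp y 2 (volume.restrict (Set.Iio b))) : MemLp y 2 volume := by
  rw [memLp_two_iff_integrable_sq_norm hy.aestronglyMeasurable] at ha hb ⊢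
  have hab : IntegrableOn (fun x => ‖y x‖ ^ 2) (Set.Icc b a) volume :=
    (hy.norm.pow 2).continuousOn.integrableOn_Icc
  rw [← integrableOn_univ]
  refine ((IntegrableOn.union hb hab).union ha).mono_set fun x _ => ?_
  rcases lt_or_ge x b with hxb | hbx
  · exact Or.inl (Or.inl hxb)
  · exact (le_or_gt x a).imp (fun hxa => Or.inr ⟨hbx, hxa⟩) id

theorem LimitCircle.memLp (hlc : LimitCircle q) {l : ℂ} (h : IsSolution q l y) :
    MemLp y 2 volume := by
  obtain ⟨⟨a, ha⟩, b, hb⟩ := hlc l y h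
  exact memLp_two_of_memLp_Ioi_of_memLp_Iio h.regular.locAC.continuous ha hb

theorem star_deriv_eq_of_im_eq_zero {w : ℝ → ℂ} (hd : Differentiable ℝ w)
    (h : ∀ x, (w x).im = 0) (x : ℝ) : star (deriv w x) = deriv w x := by
  have hstar : (fun x => star (w x)) = w := funext fun x => Complex.conj_eq_iff_im.2 (h x)
  have hderiv := (hd x).hasDerivAt.star
  rw [hstar] at hderiv
  exact hderiv.unique (hd x).hasDerivAt

/-- Square integrable real valued solutions `w₁, w₂` of `τ_q(y) = 0` with
`[w₁, w₂]_x = 1` for all `x`: a real fundamental system of `D_max` relative to which boundary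
values at `±∞` are taken. -/
structure IsL2SolutionPair (q : ℝ → ℝ) (w₁ w₂ : ℝ → ℂ) : Prop where
  solution₁ : IsSolution q 0 w₁
  solution₂ : IsSolution q 0 w₂
  real₁ : ∀ x, (w₁ x).im = 0
  real₂ : ∀ x, (w₂ x).im = 0
  memLp₁ : MemLp w₁ 2 volume
  memLp₂ : MemLp w₂ 2 volume
  bracket_eq_one : ∀ x, bracket w₁ w₂ x = 1

variable {w₁ w₂ : ℝ → ℂ}

theorem IsSolutionPair.isL2SolutionPair (hw : IsSolutionPair q w₁ w₂) (hlc : LimitCircle q) :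
    IsL2SolutionPair q w₁ w₂ where
  solution₁ := hw.solution₁
  solution₂ := hw.solution₂
  real₁ := hw.real₁
  real₂ := hw.real₂
  memLp₁ := hlc.memLp hw.solution₁
  memLp₂ := hlc.memLp hw.solution₂
  bracket_eq_one x := tendsto_nhds_unique
    (tendsto_const_nhds.congr (hw.solution₁.bracket_eq_bracket hw.solution₂ x)) hw.bracket_top

namespace HasBoundaryValues

variable {z z' : BoundarySpace}

theorem unique (h : HasBoundaryValues w₁ w₂ y z) (h' : HasBoundaryValues w₁ w₂ y z') :
    z = z' := by
  refine Prod.ext (funext fun i => ?_) (funext fun i => ?_) <;> fin_cases i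
  · exact tendsto_nhds_unique h.alpha₁ h'.alpha₁
  · exact tendsto_nhds_unique h.alpha₂ h'.alpha₂
  · exact tendsto_nhds_unique h.beta₁ h'.beta₁
  · exact tendsto_nhds_unique h.beta₂ h'.beta₂

theorem zero (w₁ w₂ : ℝ → ℂ) : HasBoundaryValues w₁ w₂ 0 0 := by
  constructor <;> rw [bracket_zero] <;> exact tendsto_const_nhds

theorem add (h : HasBoundaryValues w₁ w₂ f z) (h' : HasBoundaryValues w₁ w₂ g z')
    (hf : Regular f) (hg : Regular g) : HasBoundaryValues w₁ w₂ (f + g) (z + z') := by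
  constructor <;> rw [bracket_add hf hg]
  exacts [h.alpha₁.add h'.alpha₁, h.alpha₂.add h'.alpha₂, h.beta₁.add h'.beta₁,
    h.beta₂.add h'.beta₂]

theorem smul (h : HasBoundaryValues w₁ w₂ y z) (hy : Regular y) (c : ℂ) :
    HasBoundaryValues w₁ w₂ (c • y) (c • z) := by
  constructor <;> rw [bracket_smul hy]
  exacts [h.alpha₁.const_smul c, h.alpha₂.const_smul c, h.beta₁.const_smul c,
    h.beta₂.const_smul c]

end HasBoundaryValues

namespace IsL2SolutionPair

variable (hw : IsL2SolutionPair q w₁ w₂)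
include hw

theorem maxDomain₁ : MaxDomain q w₁ := hw.solution₁.maxDomain hw.memLp₁

theorem maxDomain₂ : MaxDomain q w₂ := hw.solution₂.maxDomain hw.memLp₂

theorem star_apply₁ (x : ℝ) : star (w₁ x) = w₁ x := Complex.conj_eq_iff_im.2 (hw.real₁ x)

theorem star_apply₂ (x : ℝ) : star (w₂ x) = w₂ x := Complex.conj_eq_iff_im.2 (hw.real₂ x)

theorem bracket₁ (f : ℝ → ℂ) (x : ℝ) : bracket w₁ f x = w₁ x * deriv f x - deriv w₁ x * f x := by
  rw [bracket, hw.star_apply₁,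
    star_deriv_eq_of_im_eq_zero hw.solution₁.regular.differentiable hw.real₁]

theorem bracket₂ (f : ℝ → ℂ) (x : ℝ) : bracket w₂ f x = w₂ x * deriv f x - deriv w₂ x * f x := by
  rw [bracket, hw.star_apply₂,
    star_deriv_eq_of_im_eq_zero hw.solution₂.regular.differentiable hw.real₂]

theorem wronskian (x : ℝ) : w₁ x * deriv w₂ x - deriv w₁ x * w₂ x = 1 := by
  rw [← hw.bracket₁, hw.bracket_eq_one]

theorem bracket_eq_planeForm_bracket (f g : ℝ → ℂ) (x : ℝ) : bracket f g x =
    planeForm ![bracket w₁ f x, bracket w₂ f x] ![bracket w₁ g x, bracket w₂ g x] := by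
  have hd₁ := star_deriv_eq_of_im_eq_zero hw.solution₁.regular.differentiable hw.real₁ x
  have hd₂ := star_deriv_eq_of_im_eq_zero hw.solution₂.regular.differentiable hw.real₂ x
  simp only [planeForm_apply, Matrix.cons_val_zero, Matrix.cons_val_one, bracket, star_sub,
    star_mul', hw.star_apply₁, hw.star_apply₂, hd₁, hd₂]
  linear_combination (-(star (f x) * deriv g x - star (deriv f x) * g x)) * hw.wronskian x

theorem exists_hasBoundaryValues (hy : MaxDomain q y) : ∃ z, HasBoundaryValues w₁ w₂ y z := by
  obtain ⟨a₁, ha₁, hb₁⟩ := hw.maxDomain₁.exists_tendsto_bracket hy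
  obtain ⟨a₂, ha₂, hb₂⟩ := hw.maxDomain₂.exists_tendsto_bracket hy
  exact ⟨(![a₁, a₂], ![_, _]), ha₁, ha₂, hb₁, hb₂⟩

theorem inner_sub_inner_eq_boundaryForm (hf : MaxDomain q f) (hg : MaxDomain q g)
    {z z' : BoundarySpace} (hz : HasBoundaryValues w₁ w₂ f z)
    (hz' : HasBoundaryValues w₁ w₂ g z') :
    inner ℂ hf.graphPoint.2 hg.graphPoint.1 - inner ℂ hf.graphPoint.1 hg.graphPoint.2 =
      boundaryForm z z' := by
  have hbracket : bracket f g = fun x => star (bracket w₁ f x) * bracket w₂ g x -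
      star (bracket w₂ f x) * bracket w₁ g x := funext (hw.bracket_eq_planeForm_bracket f g)
  obtain ⟨l, hbot, htop⟩ := hf.exists_tendsto_bracket hg
  rw [hbracket] at hbot htop
  have hl : l = planeForm z.1 z'.1 := tendsto_nhds_unique hbot
    ((hz.alpha₁.star.mul hz'.alpha₂).sub (hz.alpha₂.star.mul hz'.alpha₁))
  have hr : l + _ = planeForm z.2 z'.2 := tendsto_nhds_unique htop
    ((hz.beta₁.star.mul hz'.beta₂).sub (hz.beta₂.star.mul hz'.beta₁))
  rw [boundaryForm_apply, ← hl, ← hr, add_sub_cancel_left]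

theorem hasBoundaryValues₁ : HasBoundaryValues w₁ w₂ w₁ (![0, -1], ![0, -1]) := by
  have h₁ : bracket w₁ w₁ = fun _ => 0 := by
    funext x
    rw [hw.bracket₁]
    ring
  have h₂ : bracket w₂ w₁ = fun _ => -1 := by
    funext x
    rw [hw.bracket₂]
    linear_combination -hw.wronskian x
  constructor <;> simp [h₁, h₂]

theorem hasBoundaryValues₂ : HasBoundaryValues w₁ w₂ w₂ (![1, 0], ![1, 0]) := by
  have h₁ : bracket w₁ w₂ = fun _ => 1 := funext hw.bracket_eq_one
  have h₂ : bracket w₂ w₂ = fun _ => 0 := by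
    funext x
    rw [hw.bracket₂]
    ring
  constructor <;> simp [h₁, h₂]

theorem hasBoundaryValues_combination (a b : ℂ) :
    HasBoundaryValues w₁ w₂ (a • w₁ + b • w₂) (![b, -a], ![b, -a]) := by
  have h := (hw.hasBoundaryValues₁.smul hw.solution₁.regular a).add
    (hw.hasBoundaryValues₂.smul hw.solution₂.regular b)
    (hw.solution₁.regular.smul a) (hw.solution₂.regular.smul b)
  simpa using h

end IsL2SolutionPair

/-! ### Variation of constants -/

/-- The solution of `τ_q(y) = F` with vanishing boundary values at `-∞`, obtained from the
solutions `w₁, w₂` of the homogeneous equation by variation of constants. -/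
def variationOfConstants (w₁ w₂ F : ℝ → ℂ) (x : ℝ) : ℂ :=
  w₁ x * (∫ t in Set.Iic x, w₂ t * F t) - w₂ x * ∫ t in Set.Iic x, w₁ t * F t

namespace IsL2SolutionPair

variable {F : ℝ → ℂ} (hw : IsL2SolutionPair q w₁ w₂) (hF : MemLp F 2 volume)
include hw hF

theorem integrable_mul₁ : Integrable (fun t => w₁ t * F t) volume := hw.memLp₁.integrable_mul hF

theorem integrable_mul₂ : Integrable (fun t => w₂ t * F t) volume := hw.memLp₂.integrable_mul hF

theorem locAC_mul_setIntegral_Iic_sub {v₁ v₂ : ℝ → ℂ} (hv₁ : LocAC v₁) (hv₂ : LocAC v₂) :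
    LocAC fun x => v₁ x * (∫ t in Set.Iic x, w₂ t * F t) - v₂ x * ∫ t in Set.Iic x, w₁ t * F t :=
  (hv₁.mul (absolutelyContinuousOnInterval_setIntegral_Iic (hw.integrable_mul₂ hF))).sub
    (hv₂.mul (absolutelyContinuousOnInterval_setIntegral_Iic (hw.integrable_mul₁ hF)))

theorem ae_hasDerivAt_mul_setIntegral_Iic_sub {v₁ v₂ : ℝ → ℂ}
    (hv₁ : LocAC v₁) (hv₂ : LocAC v₂) :
    ∀ᵐ x, HasDerivAt
      (fun x => v₁ x * (∫ t in Set.Iic x, w₂ t * F t) - v₂ x * ∫ t in Set.Iic x, w₁ t * F t)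
      (deriv v₁ x * (∫ t in Set.Iic x, w₂ t * F t) - deriv v₂ x * (∫ t in Set.Iic x, w₁ t * F t) +
        (v₁ x * w₂ x - v₂ x * w₁ x) * F x) x := by
  filter_upwards [hv₁.ae_differentiableAt, hv₂.ae_differentiableAt,
    ae_hasDerivAt_setIntegral_Iic (hw.integrable_mul₁ hF),
    ae_hasDerivAt_setIntegral_Iic (hw.integrable_mul₂ hF)] with x hv₁' hv₂' hint₁ hint₂
  refine ((hv₁'.hasDerivAt.mul hint₂).sub (hv₂'.hasDerivAt.mul hint₁)).congr_deriv ?_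
  ring

theorem hasDerivAt_variationOfConstants (x : ℝ) : HasDerivAt (variationOfConstants w₁ w₂ F)
    (deriv w₁ x * (∫ t in Set.Iic x, w₂ t * F t) - deriv w₂ x * ∫ t in Set.Iic x, w₁ t * F t) x :=
  (hw.locAC_mul_setIntegral_Iic_sub hF hw.solution₁.regular.locAC
    hw.solution₂.regular.locAC).hasDerivAt
    (hw.locAC_mul_setIntegral_Iic_sub hF hw.solution₁.regular.locAC_deriv
      hw.solution₂.regular.locAC_deriv).continuous
    (by
      filter_upwards [hw.ae_hasDerivAt_mul_setIntegral_Iic_sub hF hw.solution₁.regular.locAC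
        hw.solution₂.regular.locAC] with x hx
      exact hx.congr_deriv (by ring)) x

theorem deriv_variationOfConstants : deriv (variationOfConstants w₁ w₂ F) = fun x =>
    deriv w₁ x * (∫ t in Set.Iic x, w₂ t * F t) - deriv w₂ x * ∫ t in Set.Iic x, w₁ t * F t :=
  funext fun x => (hw.hasDerivAt_variationOfConstants hF x).deriv

theorem regular_variationOfConstants : Regular (variationOfConstants w₁ w₂ F) where
  differentiable x := (hw.hasDerivAt_variationOfConstants hF x).differentiableAt
  locAC_deriv := by
    rw [hw.deriv_variationOfConstants hF]
    exact hw.locAC_mul_setIntegral_Iic_sub hF hw.solution₁.regular.locAC_deriv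
      hw.solution₂.regular.locAC_deriv

theorem tau_variationOfConstants : tau q (variationOfConstants w₁ w₂ F) =ᵐ[volume] F := by
  filter_upwards [hw.ae_hasDerivAt_mul_setIntegral_Iic_sub hF hw.solution₁.regular.locAC_deriv
    hw.solution₂.regular.locAC_deriv, hw.solution₁.tau_ae_eq_zero, hw.solution₂.tau_ae_eq_zero]
    with x hx hτ₁ hτ₂
  rw [tau, Pi.zero_apply] at hτ₁ hτ₂
  rw [tau, hw.deriv_variationOfConstants hF, hx.deriv, variationOfConstants]
  linear_combination (∫ t in Set.Iic x, w₂ t * F t) * hτ₁ -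
    (∫ t in Set.Iic x, w₁ t * F t) * hτ₂ + F x * hw.wronskian x

theorem memLp_variationOfConstants : MemLp (variationOfConstants w₁ w₂ F) 2 volume := by
  have bounded {g : ℝ → ℂ} (hg : Integrable g volume) :
      MemLp (fun x => ∫ t in Set.Iic x, g t) ⊤ volume :=
    memLp_top_of_bound
      (LocAC.continuous (absolutelyContinuousOnInterval_setIntegral_Iic hg)).aestronglyMeasurable
      (∫ t, ‖g t‖) (Eventually.of_forall fun x => norm_setIntegral_le_integral_norm hg _)
  exact ((bounded (hw.integrable_mul₂ hF)).mul' hw.memLp₁).sub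
    ((bounded (hw.integrable_mul₁ hF)).mul' hw.memLp₂)

theorem maxDomain_variationOfConstants : MaxDomain q (variationOfConstants w₁ w₂ F) :=
  ⟨hw.regular_variationOfConstants hF, hw.memLp_variationOfConstants hF,
    hF.ae_eq (hw.tau_variationOfConstants hF).symm⟩

theorem bracket₁_variationOfConstants (x : ℝ) :
    bracket w₁ (variationOfConstants w₁ w₂ F) x = -∫ t in Set.Iic x, w₁ t * F t := by
  rw [hw.bracket₁, hw.deriv_variationOfConstants hF, variationOfConstants]
  linear_combination (-∫ t in Set.Iic x, w₁ t * F t) * hw.wronskian x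

theorem bracket₂_variationOfConstants (x : ℝ) :
    bracket w₂ (variationOfConstants w₁ w₂ F) x = -∫ t in Set.Iic x, w₂ t * F t := by
  rw [hw.bracket₂, hw.deriv_variationOfConstants hF, variationOfConstants]
  linear_combination (-∫ t in Set.Iic x, w₂ t * F t) * hw.wronskian x

theorem hasBoundaryValues_variationOfConstants :
    HasBoundaryValues w₁ w₂ (variationOfConstants w₁ w₂ F)
      (0, ![-∫ t, w₁ t * F t, -∫ t, w₂ t * F t]) := by
  have hbot (g : ℝ → ℂ) : Tendsto (fun x => -∫ t in Set.Iic x, g t) atBot (𝓝 0) := by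
    simpa only [neg_zero, id_eq] using
      (tendsto_integral_Iic_zero (f := g) (μ := volume) tendsto_id).neg
  have h₁ := funext (hw.bracket₁_variationOfConstants hF)
  have h₂ := funext (hw.bracket₂_variationOfConstants hF)
  constructor
  · exact h₁ ▸ hbot _
  · exact h₂ ▸ hbot _
  · exact h₁ ▸ (tendsto_setIntegral_Iic_atTop (hw.integrable_mul₁ hF)).neg
  · exact h₂ ▸ (tendsto_setIntegral_Iic_atTop (hw.integrable_mul₂ hF)).neg

omit hF

/-- The classes in `L²(ℝ)` of the solutions `w₁` and `w₂`. -/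
def solutionClass : Fin 2 → L2 := ![hw.memLp₁.toLp w₁, hw.memLp₂.toLp w₂]

theorem exists_graphPoint_snd_eq (F : L2) :
    ∃ y, ∃ hy : MaxDomain q y, hy.graphPoint.2 = F ∧
      HasBoundaryValues w₁ w₂ y (0, fun i => -inner ℂ (hw.solutionClass i) F) := by
  have hF := Lp.memLp F
  refine ⟨_, hw.maxDomain_variationOfConstants hF,
    Lp.ext ((hw.maxDomain_variationOfConstants hF).memLp_tau.coeFn_toLp.trans
      (hw.tau_variationOfConstants hF)), ?_⟩
  convert hw.hasBoundaryValues_variationOfConstants hF using 2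
  ext i
  have hinner {w : ℝ → ℂ} (hw : MemLp w 2 volume) (hstar : ∀ x, star (w x) = w x) :
      inner ℂ (hw.toLp w) F = ∫ t, w t * F t := by
    rw [← Lp.toLp_coeFn F hF, inner_toLp hw hF, Lp.toLp_coeFn]
    simp only [hstar]
  fin_cases i
  · exact congrArg Neg.neg (hinner hw.memLp₁ hw.star_apply₁)
  · exact congrArg Neg.neg (hinner hw.memLp₂ hw.star_apply₂)

theorem linearIndependent_solutionClass : LinearIndependent ℂ hw.solutionClass := by
  refine LinearIndependent.pair_iff.2 fun a b hab => ?_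
  have hclass : ((hw.maxDomain₁.smul a).add (hw.maxDomain₂.smul b)).graphPoint.1 =
      (MaxDomain.zero q).graphPoint.1 := hab
  have hzero := MaxDomain.eq_of_graphPoint_fst_eq _ _ hclass
  have hvalues := hw.hasBoundaryValues_combination a b
  rw [hzero] at hvalues
  have h := congrArg Prod.fst (hvalues.unique (HasBoundaryValues.zero w₁ w₂))
  exact ⟨neg_eq_zero.1 (congrFun h 1), congrFun h 0⟩

end IsL2SolutionPair

open scoped ComplexOrder in
theorem exists_inner_eq_of_linearIndependent {𝕜 E ι : Type*} [RCLike 𝕜] [NormedAddCommGroup E]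
    [InnerProductSpace 𝕜 E] [Finite ι] {v : ι → E} (hv : LinearIndependent 𝕜 v) (c : ι → 𝕜) :
    ∃ x, ∀ i, inner 𝕜 (v i) x = c i := by
  classical
  have := Fintype.ofFinite ι
  obtain ⟨a, ha⟩ := Matrix.mulVec_surjective_iff_isUnit.2
    (Matrix.posDef_gram_of_linearIndependent hv).isUnit c
  refine ⟨∑ j, a j • v j, fun i => ?_⟩
  rw [← ha, inner_sum]
  refine Finset.sum_congr rfl fun j _ => ?_
  rw [inner_smul_right, mul_comm]
  rfl

/-! ### Adjoints of extensions -/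

theorem mem_graph_extension_iff {B : Submodule ℂ BoundarySpace} {p : L2 × L2} :
    p ∈ (extension q w₁ w₂ B).graph ↔ ∃ y, ∃ hy : MaxDomain q y, p = hy.graphPoint ∧
      ∃ z ∈ B, HasBoundaryValues w₁ w₂ y z := by
  constructor
  · intro hp
    have hmax : p ∈ (maxOp q).graph := LinearPMap.le_graph_of_le LinearPMap.domRestrict_le hp
    rw [maxOp_graph] at hmax
    obtain ⟨y, hy, rfl⟩ := mem_maxGraph_iff.1 hmax
    obtain ⟨y', hy', hae, z, hz, hyz⟩ := (LinearPMap.mem_domain_of_mem_graph hp).1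
    obtain rfl := hy.eq_of_ae_eq hy' (hy.memLp.coeFn_toLp.symm.trans hae)
    exact ⟨y, hy, rfl, z, hz, hyz⟩
  · rintro ⟨y, hy, rfl, z, hz, hyz⟩
    have hmax : hy.graphPoint ∈ (maxOp q).graph := by
      rw [maxOp_graph]
      exact mem_maxGraph_iff.2 ⟨y, hy, rfl⟩
    obtain ⟨u, hu, hu'⟩ := (LinearPMap.mem_graph_iff _).1 hmax
    have hdomain : (u : L2) ∈ (extension q w₁ w₂ B).domain :=
      ⟨⟨y, hy, hu ▸ hy.memLp.coeFn_toLp, z, hz, hyz⟩, u.2⟩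
    exact (LinearPMap.mem_graph_iff _).2 ⟨⟨u, hdomain⟩, hu, hu'⟩

namespace IsL2SolutionPair

variable (hw : IsL2SolutionPair q w₁ w₂)
include hw

theorem exists_maxDomain_hasBoundaryValues (z : BoundarySpace) :
    ∃ y, MaxDomain q y ∧ HasBoundaryValues w₁ w₂ y z := by
  obtain ⟨F, hF⟩ := exists_inner_eq_of_linearIndependent hw.linearIndependent_solutionClass
    (z.1 - z.2)
  obtain ⟨y, hy, -, hyz⟩ := hw.exists_graphPoint_snd_eq F
  have hcomb := (hw.maxDomain₁.smul (-z.1 1)).add (hw.maxDomain₂.smul (z.1 0))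
  have hvalues := hyz.add (hw.hasBoundaryValues_combination (-z.1 1) (z.1 0)) hy.regular
    hcomb.regular
  refine ⟨_, hy.add hcomb, ?_⟩
  convert hvalues using 1
  refine Prod.ext (funext fun i => ?_) (funext fun i => ?_) <;> fin_cases i <;>
    simp [-Matrix.cons_add, -Matrix.add_cons, hF]

theorem span_solutionClass_le_comap_inl :
    Submodule.span ℂ (Set.range hw.solutionClass) ≤
      (maxGraph q).comap (LinearMap.inl ℂ L2 L2) := by
  refine Submodule.span_le.2 ?_
  rintro - ⟨i, rfl⟩
  have hsolution {w : ℝ → ℂ} (hw : MemLp w 2 volume) (h : IsSolution q 0 w) :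
      (hw.toLp w, (0 : L2)) ∈ maxGraph q :=
    ⟨w, h.maxDomain hw, hw.coeFn_toLp, (Lp.coeFn_zero ℂ 2 volume).trans h.tau_ae_eq_zero.symm⟩
  fin_cases i
  · exact hsolution hw.memLp₁ hw.solution₁
  · exact hsolution hw.memLp₂ hw.solution₂

theorem sub_graphPoint_fst_mem_span {B : Submodule ℂ BoundarySpace} {p : L2 × L2}
    (hp : p ∈ (extension q w₁ w₂ B).graph.adjoint) (hy : MaxDomain q y)
    (hsnd : hy.graphPoint.2 = p.2) :
    p.1 - hy.graphPoint.1 ∈ Submodule.span ℂ (Set.range hw.solutionClass) := by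
  have := FiniteDimensional.span_of_finite ℂ (Set.finite_range hw.solutionClass)
  rw [← Submodule.orthogonal_orthogonal (Submodule.span ℂ (Set.range hw.solutionClass)),
    Submodule.mem_orthogonal]
  intro F hF
  obtain ⟨f, hf, rfl, hfz⟩ := hw.exists_graphPoint_snd_eq F
  have hzero : (fun i => -inner ℂ (hw.solutionClass i) hf.graphPoint.2) = (0 : Fin 2 → ℂ) :=
    funext fun i => neg_eq_zero.2
      ((Submodule.mem_orthogonal _ _).1 hF _ (Submodule.subset_span ⟨i, rfl⟩))
  rw [hzero, Prod.mk_zero_zero] at hfz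
  have hadj : inner ℂ hf.graphPoint.2 p.1 - inner ℂ hf.graphPoint.1 p.2 = 0 :=
    (Submodule.mem_adjoint_iff _ _).1 hp _ _
      (mem_graph_extension_iff.2 ⟨f, hf, rfl, 0, B.zero_mem, hfz⟩)
  obtain ⟨z, hz⟩ := hw.exists_hasBoundaryValues hy
  have hgreen := hw.inner_sub_inner_eq_boundaryForm hf hy hfz hz
  rw [map_zero, LinearMap.zero_apply, hsnd] at hgreen
  rw [inner_sub_right]
  linear_combination hadj - hgreen

theorem adjoint_graph_extension_le (B : Submodule ℂ BoundarySpace) :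
    (extension q w₁ w₂ B).graph.adjoint ≤ maxGraph q := by
  intro p hp
  obtain ⟨y, hy, hsnd, -⟩ := hw.exists_graphPoint_snd_eq p.2
  have hsum := (maxGraph q).add_mem (mem_maxGraph_iff.2 ⟨y, hy, rfl⟩)
    (hw.span_solutionClass_le_comap_inl (hw.sub_graphPoint_fst_mem_span hp hy hsnd))
  convert hsum using 1
  ext1 <;> simp [hsnd]

theorem dense_domain_extension (B : Submodule ℂ BoundarySpace) :
    Dense ((extension q w₁ w₂ B).domain : Set L2) := by
  rw [Submodule.dense_iff_topologicalClosure_eq_top, Submodule.topologicalClosure_eq_top_iff,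
    Submodule.eq_bot_iff]
  intro h hh
  have hadj : ((0 : L2), h) ∈ (extension q w₁ w₂ B).graph.adjoint := by
    refine (Submodule.mem_adjoint_iff _ _).2 fun a b hab => ?_
    rw [inner_zero_right, zero_sub, neg_eq_zero]
    exact (Submodule.mem_orthogonal _ _).1 hh a (LinearPMap.mem_domain_of_mem_graph hab)
  have hmax := hw.adjoint_graph_extension_le B hadj
  rw [← maxOp_graph] at hmax
  exact LinearPMap.graph_fst_eq_zero_snd _ hmax rfl

theorem adjoint_graph_extension (B : Submodule ℂ BoundarySpace) :
    (extension q w₁ w₂ B).graph.adjoint =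
      (extension q w₁ w₂ (B.orthogonalBilin boundaryForm)).graph := by
  ext p
  constructor
  · intro hp
    obtain ⟨y, hy, rfl⟩ := mem_maxGraph_iff.1 (hw.adjoint_graph_extension_le B hp)
    obtain ⟨z, hz⟩ := hw.exists_hasBoundaryValues hy
    refine mem_graph_extension_iff.2 ⟨y, hy, rfl, z, ?_, hz⟩
    refine Submodule.mem_orthogonalBilin_iff.2 fun z' hz' => ?_
    obtain ⟨f, hf, hfz⟩ := hw.exists_maxDomain_hasBoundaryValues z'
    rw [← hw.inner_sub_inner_eq_boundaryForm hf hy hfz hz]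
    exact (Submodule.mem_adjoint_iff _ _).1 hp _ _
      (mem_graph_extension_iff.2 ⟨f, hf, rfl, z', hz', hfz⟩)
  · intro hp
    obtain ⟨y, hy, rfl, z, hz, hyz⟩ := mem_graph_extension_iff.1 hp
    refine (Submodule.mem_adjoint_iff _ _).2 fun a b hab => ?_
    obtain ⟨f, hf, hab, z', hz', hfz⟩ := mem_graph_extension_iff.1 hab
    obtain ⟨rfl, rfl⟩ := Prod.ext_iff.1 hab
    rw [hw.inner_sub_inner_eq_boundaryForm hf hy hfz hyz]
    exact Submodule.mem_orthogonalBilin_iff.1 hz z' hz'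

theorem adjoint_extension (B : Submodule ℂ BoundarySpace) :
    (extension q w₁ w₂ B).adjoint = extension q w₁ w₂ (B.orthogonalBilin boundaryForm) :=
  LinearPMap.eq_of_eq_graph <|
    (LinearPMap.adjoint_graph_eq_graph_adjoint (hw.dense_domain_extension B)).trans
      (hw.adjoint_graph_extension B)

theorem extension_injective : Function.Injective (extension q w₁ w₂) := by
  have hle {B B' : Submodule ℂ BoundarySpace} (h : extension q w₁ w₂ B = extension q w₁ w₂ B') :
      B ≤ B' := by
    intro z hz
    obtain ⟨y, hy, hyz⟩ := hw.exists_maxDomain_hasBoundaryValues z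
    have hmem : hy.graphPoint ∈ (extension q w₁ w₂ B').graph :=
      h ▸ mem_graph_extension_iff.2 ⟨y, hy, rfl, z, hz, hyz⟩
    obtain ⟨y', hy', hp, z', hz', hyz'⟩ := mem_graph_extension_iff.1 hmem
    obtain rfl := hy.eq_of_graphPoint_fst_eq hy' (congrArg Prod.fst hp)
    rwa [hyz.unique hyz']
  exact fun B B' h => le_antisymm (hle h) (hle h.symm)

theorem isSelfAdjoint_extension_iff (B : Submodule ℂ BoundarySpace) :
    IsSelfAdjoint (extension q w₁ w₂ B) ↔ B.orthogonalBilin boundaryForm = B := by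
  rw [LinearPMap.isSelfAdjoint_def, hw.adjoint_extension, hw.extension_injective.eq_iff]

end IsL2SolutionPair

/-! ### Separated boundary conditions -/

theorem mul_cos_ne_zero_or_neg_sin_ne_zero {ξ : ℂ} (hξ : ξ ≠ 0) (α : ℝ) :
    ξ * (Real.cos α : ℂ) ≠ 0 ∨ -(Real.sin α : ℂ) ≠ 0 := by
  rw [neg_ne_zero, mul_ne_zero_iff_left hξ, Complex.ofReal_ne_zero, Complex.ofReal_ne_zero]
  by_contra! h
  simpa [h.1, h.2] using Real.cos_sq_add_sin_sq α

theorem star_eq_self_iff_of_norm_eq_one {ξ : ℂ} (hξ : ‖ξ‖ = 1) :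
    star ξ = ξ ↔ ξ = 1 ∨ ξ = -1 := by
  rw [← mul_self_eq_one_iff]
  have hstar : star ξ * ξ = 1 := by
    rw [RCLike.star_def, RCLike.conj_mul, hξ, RCLike.ofReal_one, one_pow]
  refine ⟨fun h => by rwa [h] at hstar, fun h => ?_⟩
  exact mul_right_cancel₀ (left_ne_zero_of_mul_eq_one h) (hstar.trans h.symm)

theorem star_mul_cos_mul_neg_sin_eq_iff {ξ : ℂ} (hξ : ‖ξ‖ = 1) (α : ℝ) :
    star (ξ * (Real.cos α : ℂ)) * -(Real.sin α : ℂ) =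
        ξ * (Real.cos α : ℂ) * star (-(Real.sin α : ℂ)) ↔
      Real.sin α * Real.cos α = 0 ∨ ξ = 1 ∨ ξ = -1 := by
  rw [← star_eq_self_iff_of_norm_eq_one hξ, ← sub_eq_zero (a := star ξ),
    ← Complex.ofReal_eq_zero, ← mul_eq_zero, star_neg, star_mul', RCLike.star_def,
    Complex.conj_ofReal, Complex.conj_ofReal, Complex.ofReal_mul]
  constructor <;> intro h <;> linear_combination -h

theorem Normalized.or_eq_one_or_iff_eq_one {ξ : ℂ} {α : ℝ} (h : Normalized ξ α) :
    (Real.sin α * Real.cos α = 0 ∨ ξ = 1 ∨ ξ = -1) ↔ ξ = 1 := by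
  rw [or_iff_left h.2, or_iff_right_of_imp h.1]

theorem exists_norm_eq_one_ne_neg_one_mul_ofReal (w : ℂ) :
    ∃ (ξ : ℂ) (t : ℝ), ‖ξ‖ = 1 ∧ ξ ≠ -1 ∧ w = ξ * t := by
  rcases eq_or_ne (Complex.exp (w.arg * Complex.I)) (-1) with h | h
  · refine ⟨1, -‖w‖, norm_one, by norm_num, ?_⟩
    rw [one_mul, Complex.ofReal_neg, ← mul_neg_one, ← h, Complex.norm_mul_exp_arg_mul_I]
  · refine ⟨_, ‖w‖, Complex.norm_exp_ofReal_mul_I _, h, ?_⟩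
    rw [mul_comm, Complex.norm_mul_exp_arg_mul_I]

theorem exists_normalized (a b : ℂ) :
    ∃ ξ : ℂ, ∃ α ∈ Set.Ico 0 (2 * Real.pi), ‖ξ‖ = 1 ∧ Normalized ξ α ∧
      a * -(Real.sin α : ℂ) = ξ * (Real.cos α : ℂ) * b := by
  have hpi := Real.pi_pos
  have hone (α : ℝ) : Normalized 1 α := ⟨fun _ => rfl, by norm_num⟩
  rcases eq_or_ne a 0 with rfl | ha
  · exact ⟨1, Real.pi / 2, ⟨by linarith, by linarith⟩, norm_one, hone _, by simp⟩
  rcases eq_or_ne b 0 with rfl | hb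
  · exact ⟨1, 0, ⟨le_rfl, by linarith⟩, norm_one, hone _, by simp⟩
  -- The condition means `ξ cot α = -a / b`.
  obtain ⟨ξ, t, hξ, hξ', hratio⟩ := exists_norm_eq_one_ne_neg_one_mul_ofReal (-a / b)
  have ht : t ≠ 0 := by
    rintro rfl
    simp [ha, hb] at hratio
  have hsin : Real.sin (Real.pi / 2 - Real.arctan t) ≠ 0 := by
    rw [Real.sin_pi_div_two_sub]
    exact (Real.cos_arctan_pos t).ne'
  have hcos : Real.cos (Real.pi / 2 - Real.arctan t) =
      t * Real.sin (Real.pi / 2 - Real.arctan t) := by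
    rw [Real.sin_pi_div_two_sub, Real.cos_pi_div_two_sub, Real.sin_arctan, Real.cos_arctan,
      mul_one_div]
  refine ⟨ξ, Real.pi / 2 - Real.arctan t, ⟨?_, ?_⟩, hξ, ⟨fun h => ?_, hξ'⟩, ?_⟩
  · linarith [Real.arctan_lt_pi_div_two t]
  · linarith [Real.neg_pi_div_two_lt_arctan t]
  · exact absurd h (mul_ne_zero hsin (hcos ▸ mul_ne_zero ht hsin))
  · rw [div_eq_iff hb] at hratio
    rw [hcos, Complex.ofReal_mul]
    linear_combination (Real.sin (Real.pi / 2 - Real.arctan t) : ℂ) * hratio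

theorem exists_separatedBC_eq_normSeparatedBC {a b c d : ℂ} (hab : a ≠ 0 ∨ b ≠ 0)
    (hcd : c ≠ 0 ∨ d ≠ 0) :
    ∃ ξ η : ℂ, ∃ α ∈ Set.Ico 0 (2 * Real.pi), ∃ β ∈ Set.Ico 0 (2 * Real.pi),
      ‖ξ‖ = 1 ∧ ‖η‖ = 1 ∧ Normalized ξ α ∧ Normalized η β ∧
        separatedBC a b c d = normSeparatedBC ξ η α β := by
  obtain ⟨ξ, α, hα, hξ, hξα, hbot⟩ := exists_normalized a b
  obtain ⟨η, β, hβ, hη, hηβ, htop⟩ := exists_normalized c d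
  exact ⟨ξ, η, α, hα, β, hβ, hξ, hη, hξα, hηβ, (separatedBC_eq_iff hab hcd
    (mul_cos_ne_zero_or_neg_sin_ne_zero (norm_ne_zero_iff.1 (hξ ▸ one_ne_zero)) α)
    (mul_cos_ne_zero_or_neg_sin_ne_zero (norm_ne_zero_iff.1 (hη ▸ one_ne_zero)) β)).2
    ⟨hbot, htop⟩⟩

theorem orthogonalBilin_normSeparatedBC_eq_iff {ξ η : ℂ} (hξ : ‖ξ‖ = 1) (hη : ‖η‖ = 1)
    (α β : ℝ) : (normSeparatedBC ξ η α β).orthogonalBilin boundaryForm = normSeparatedBC ξ η α β ↔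
      (Real.sin α * Real.cos α = 0 ∨ ξ = 1 ∨ ξ = -1) ∧
        (Real.sin β * Real.cos β = 0 ∨ η = 1 ∨ η = -1) := by
  have hbot := mul_cos_ne_zero_or_neg_sin_ne_zero (norm_ne_zero_iff.1 (hξ ▸ one_ne_zero)) α
  have htop := mul_cos_ne_zero_or_neg_sin_ne_zero (norm_ne_zero_iff.1 (hη ▸ one_ne_zero)) β
  rw [normSeparatedBC, orthogonalBilin_separatedBC hbot htop,
    separatedBC_eq_iff (hbot.imp star_ne_zero.2 star_ne_zero.2)
      (htop.imp star_ne_zero.2 star_ne_zero.2) hbot htop,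
    star_mul_cos_mul_neg_sin_eq_iff hξ, star_mul_cos_mul_neg_sin_eq_iff hη]

/-! ### Mixed boundary conditions -/

theorem orthogonalBilin_mixedBC₁_eq_iff {M : Matrix (Fin 2) (Fin 2) ℂ} :
    (mixedBC₁ M).orthogonalBilin boundaryForm = mixedBC₁ M ↔ formAdjoint M * M = 1 := by
  rw [orthogonalBilin_mixedBC₁, mixedBC₂_eq_mixedBC₁_iff]

theorem orthogonalBilin_mixedBC₂_eq_iff {M : Matrix (Fin 2) (Fin 2) ℂ} :
    (mixedBC₂ M).orthogonalBilin boundaryForm = mixedBC₂ M ↔ formAdjoint M * M = 1 := by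
  rw [orthogonalBilin_mixedBC₂, eq_comm, mixedBC₂_eq_mixedBC₁_iff, mul_eq_one_comm]

theorem exists_exp_neg_I_mul_mul_eq_ofReal_iff (φ : ℝ) (x : ℂ) :
    (∃ r : ℝ, Complex.exp (-Complex.I * φ) * x = r) ↔
      x = Complex.exp (2 * Complex.I * φ) * star x := by
  have hconj : star (Complex.exp (-Complex.I * φ)) = Complex.exp (Complex.I * φ) := by
    rw [RCLike.star_def, ← Complex.exp_conj]
    simp
  have hinv : Complex.exp (Complex.I * φ) * Complex.exp (-Complex.I * φ) = 1 := by
    rw [← Complex.exp_add]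
    simp
  have hsq : Complex.exp (2 * Complex.I * φ) =
      Complex.exp (Complex.I * φ) * Complex.exp (Complex.I * φ) := by
    rw [← Complex.exp_add]
    ring_nf
  rw [← Complex.conj_eq_iff_real, ← RCLike.star_def, star_mul', hconj, hsq]
  constructor <;> intro h
  · linear_combination -Complex.exp (Complex.I * φ) * h - x * hinv
  · linear_combination -Complex.exp (-Complex.I * φ) * h -
      Complex.exp (Complex.I * φ) * star x * hinv

theorem exists_eq_exp_two_mul_I_mul_iff (z : ℂ) :
    (∃ φ : ℝ, z = Complex.exp (2 * Complex.I * φ)) ↔ star z * z = 1 := by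
  have hnorm : star z * z = 1 ↔ ‖z‖ = 1 := by
    rw [RCLike.star_def, Complex.conj_mul', ← pow_eq_one_iff_of_nonneg (norm_nonneg z) two_ne_zero]
    norm_cast
  rw [hnorm, Complex.norm_eq_one_iff]
  constructor
  · rintro ⟨φ, rfl⟩
    exact ⟨2 * φ, by push_cast; ring_nf⟩
  · rintro ⟨θ, rfl⟩
    exact ⟨θ / 2, by push_cast; ring_nf⟩

theorem mixedCriterion_iff {a b c d : ℂ} :
    MixedCriterion a b c d ↔ formAdjoint !![a, b; c, d] * !![a, b; c, d] = 1 := by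
  have hentries : !![a, b; c, d] = !![a, b; c, d].det • !![a, b; c, d].map star ↔
      a = (a * d - b * c) * star a ∧ b = (a * d - b * c) * star b ∧
        c = (a * d - b * c) * star c ∧ d = (a * d - b * c) * star d := by
    simp [← Matrix.ext_iff, Fin.forall_fin_two, and_assoc]
  rw [formAdjoint_mul_self_eq_one_iff, ← exists_eq_exp_two_mul_I_mul_iff, hentries,
    Matrix.det_fin_two_of, ← exists_and_right]
  simp only [MixedCriterion, exists_exp_neg_I_mul_mul_eq_ofReal_iff]
  refine exists_congr fun φ => and_congr_right fun hφ => ?_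
  rw [hφ]

end SturmLiouville

end

theorem mainTheorem7_general (q : ℝ → ℝ) (w₁ w₂ : ℝ → ℂ)
    (hw : SturmLiouville.IsL2SolutionPair q w₁ w₂) :
    (∀ ξ η : ℂ, ‖ξ‖ = 1 → ‖η‖ = 1 → ∀ α β : ℝ,
      (IsSelfAdjoint (SturmLiouville.extension q w₁ w₂
          (SturmLiouville.normSeparatedBC ξ η α β)) ↔
        (Real.sin α * Real.cos α = 0 ∨ ξ = 1 ∨ ξ = -1) ∧
        (Real.sin β * Real.cos β = 0 ∨ η = 1 ∨ η = -1))) ∧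
    (∀ ξ η : ℂ, ‖ξ‖ = 1 → ‖η‖ = 1 → ∀ α β : ℝ,
      SturmLiouville.Normalized ξ α → SturmLiouville.Normalized η β →
      (IsSelfAdjoint (SturmLiouville.extension q w₁ w₂
          (SturmLiouville.normSeparatedBC ξ η α β)) ↔ ξ = 1 ∧ η = 1)) ∧
    (∀ a b c d : ℂ, (a ≠ 0 ∨ b ≠ 0) → (c ≠ 0 ∨ d ≠ 0) →
      ∃ ξ η : ℂ, ∃ α ∈ Set.Ico 0 (2 * Real.pi), ∃ β ∈ Set.Ico 0 (2 * Real.pi),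
        ‖ξ‖ = 1 ∧ ‖η‖ = 1 ∧
        SturmLiouville.Normalized ξ α ∧ SturmLiouville.Normalized η β ∧
        SturmLiouville.extension q w₁ w₂ (SturmLiouville.separatedBC a b c d) =
          SturmLiouville.extension q w₁ w₂ (SturmLiouville.normSeparatedBC ξ η α β)) ∧
    (∀ a b c d : ℂ,
      (IsSelfAdjoint (SturmLiouville.extension q w₁ w₂
          (SturmLiouville.mixedBC₁ !![a, b; c, d])) ↔ SturmLiouville.MixedCriterion a b c d) ∧
      (IsSelfAdjoint (SturmLiouville.extension q w₁ w₂
          (SturmLiouville.mixedBC₂ !![a, b; c, d])) ↔ SturmLiouville.MixedCriterion a b c d)) := by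
  simp only [hw.isSelfAdjoint_extension_iff, SturmLiouville.mixedCriterion_iff,
    SturmLiouville.orthogonalBilin_mixedBC₁_eq_iff, SturmLiouville.orthogonalBilin_mixedBC₂_eq_iff]
  refine ⟨fun ξ η hξ hη => SturmLiouville.orthogonalBilin_normSeparatedBC_eq_iff hξ hη,
    fun ξ η hξ hη α β hξα hηβ => ?_, fun a b c d hab hcd => ?_,
    fun _ _ _ _ => ⟨trivial, trivial⟩⟩
  · rw [SturmLiouville.orthogonalBilin_normSeparatedBC_eq_iff hξ hη,
      hξα.or_eq_one_or_iff_eq_one, hηβ.or_eq_one_or_iff_eq_one]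
  · obtain ⟨ξ, η, α, hα, β, hβ, hξ, hη, hξα, hηβ, heq⟩ :=
      SturmLiouville.exists_separatedBC_eq_normSeparatedBC hab hcd
    exact ⟨ξ, η, α, hα, β, hβ, hξ, hη, hξα, hηβ, congrArg _ heq⟩

theorem mainTheorem7 (q : ℝ → ℝ) (hq : LocallyIntegrable q volume) (hq_even : ∀ x, q (-x) = q x)
    (hlc : SturmLiouville.LimitCircle q) (w₁ w₂ : ℝ → ℂ)
    (hw : SturmLiouville.IsSolutionPair q w₁ w₂) :
    -- separated boundary conditions, arbitrary parameters
    (∀ ξ η : ℂ, ‖ξ‖ = 1 → ‖η‖ = 1 →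
      ∀ α ∈ Set.Ico 0 (2 * Real.pi), ∀ β ∈ Set.Ico 0 (2 * Real.pi),
        (IsSelfAdjoint (SturmLiouville.extension q w₁ w₂
            (SturmLiouville.normSeparatedBC ξ η α β)) ↔
          (Real.sin α * Real.cos α = 0 ∨ ξ = 1 ∨ ξ = -1) ∧
          (Real.sin β * Real.cos β = 0 ∨ η = 1 ∨ η = -1))) ∧
    -- separated boundary conditions, normalized parameters
    (∀ ξ η : ℂ, ‖ξ‖ = 1 → ‖η‖ = 1 →
      ∀ α ∈ Set.Ico 0 (2 * Real.pi), ∀ β ∈ Set.Ico 0 (2 * Real.pi),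
        SturmLiouville.Normalized ξ α → SturmLiouville.Normalized η β →
        (IsSelfAdjoint (SturmLiouville.extension q w₁ w₂
            (SturmLiouville.normSeparatedBC ξ η α β)) ↔ ξ = 1 ∧ η = 1)) ∧
    -- all separated boundary conditions can be normalized
    (∀ a b c d : ℂ, (a ≠ 0 ∨ b ≠ 0) → (c ≠ 0 ∨ d ≠ 0) →
      ∃ ξ η : ℂ, ∃ α ∈ Set.Ico 0 (2 * Real.pi), ∃ β ∈ Set.Ico 0 (2 * Real.pi),
        ‖ξ‖ = 1 ∧ ‖η‖ = 1 ∧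
        SturmLiouville.Normalized ξ α ∧ SturmLiouville.Normalized η β ∧
        SturmLiouville.extension q w₁ w₂ (SturmLiouville.separatedBC a b c d) =
          SturmLiouville.extension q w₁ w₂ (SturmLiouville.normSeparatedBC ξ η α β)) ∧
    -- mixed boundary conditions, of both forms
    (∀ a b c d : ℂ,
      (IsSelfAdjoint (SturmLiouville.extension q w₁ w₂
          (SturmLiouville.mixedBC₁ !![a, b; c, d])) ↔ SturmLiouville.MixedCriterion a b c d) ∧
      (IsSelfAdjoint (SturmLiouville.extension q w₁ w₂
          (SturmLiouville.mixedBC₂ !![a, b; c, d])) ↔ SturmLiouville.MixedCriterion a b c d)) := by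
  obtain ⟨hsep, hnorm, hexists, hmixed⟩ :=
    mainTheorem7_general q w₁ w₂ (hw.isL2SolutionPair hlc)
  exact ⟨fun ξ η hξ hη α _ β _ => hsep ξ η hξ hη α β,
    fun ξ η hξ hη α _ β _ => hnorm ξ η hξ hη α β, hexists, hmixed⟩
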